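/- Let $p$ be a prime and let $d\ge 3$, $e\ge 5$, $k\ge 1$, $n\ge 4$ be integers. Let $R=R_{e,k}$ be the Galois ring $(\mathbb{Z}/p^e\mathbb{Z})[x]/(f)$, where $f$ is a monic polynomial of degree $k$ over $\mathbb{Z}/p^e\mathbb{Z}$ whose reduction modulo $p$ is irreducible over $\mathbb{Z}/p\mathbb{Z}$. Let $E\subset R^d$ and let $b\in R^n$ be a fixed row vector. Let $$S=\bigl|\{(a,A) : a\in E,\ A \text{ a } d\times n \text{ matrix over } R \text{ all of whose columns lie in } E,\ aA=b\}\bigr|,$$ where $a$ is regarded as a row vector. If $$|E|>\sqrt{14}\,e\,n\,p^{\,dek-\frac{dk}{2}+\frac{nek}{2}+\frac n2-\frac{ek}{2}+k},$$ then $$S\le \frac{2|E|^{n+1}}{p^{nek}}.$$ -/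

import Mathlib

open Polynomial

/-- `R` is a Galois ring `R_{e,k}` of characteristic `p ^ e` and rank `k`: it is isomorphic to
`(ℤ/p^e)[x]/(f)` for a monic polynomial `f` of degree `k` over `ℤ/p^e` whose reduction modulo `p`
is irreducible over `ℤ/p`. (The divisibility `p ∣ p ^ e` only says that reduction `ℤ/p^e → ℤ/p`
makes sense.) -/
def IsGaloisRing (p e k : ℕ) (R : Type*) [CommRing R] : Prop :=
  ∃ (h : p ∣ p ^ e) (f : (ZMod (p ^ e))[X]),
    f.Monic ∧ f.natDegree = k ∧ Irreducible (f.map (ZMod.castHom h (ZMod p))) ∧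
      Nonempty (R ≃+* AdjoinRoot f)

/-- The set of pairs `(a, A)`, with `a` a row vector in `E` and `A` a `d × n` matrix all of whose
columns lie in `E`, that solve `a A = b`. -/
def rowMatrixSolutions {R : Type*} [CommRing R] {d n : ℕ}
    (E : Finset (Fin d → R)) (b : Fin n → R) :
    Set ((Fin d → R) × Matrix (Fin d) (Fin n) R) :=
  {s | s.1 ∈ E ∧ (∀ j : Fin n, s.2.col j ∈ E) ∧ Matrix.vecMul s.1 s.2 = b}

/-!
For fixed `a`, the columns of `A` are chosen independently, so the number of solutions is
`∑ a ∈ E, ∏ j, ν_{b j}(a)`, where `ν_t(a)` is the number of `c ∈ E` with `a ⬝ᵥ c = t`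
(`incidences`). On average over all `a` and `t`, `ν_t` has value `μ = |E| / |R|`, and the theorem
holds because `ν_t` deviates little from `μ` in mean square.

Write `q = |R|` and let `r` be the size of the residue field. The ring has a primitive additive
character: any character nontrivial on the generator `p ^ (e - 1)` of the socle will do, since each
nonzero element divides this generator (`IsChainUniformizer.exists_isPrimitive`). Expanding `ν_t` in
this character, orthogonality and Cauchy–Schwarz give
`∑ a, (q ν_t(a) - |E|) ^ 2 ≤ q ^ (d + 1) |E| ∑ s ≠ 0, |ann s| ^ d`
(`AddChar.IsPrimitive.sum_sq_incidences_sub_le`). As every nonzero element is `p ^ i` times a unit,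
the last sum is at most `e r ^ (1 + (e - 1) d)` (`IsChainUniformizer.sum_card_ann_pow_le`).

By AM-GM the product over `j` may be replaced by `ν_t ^ n`, and Taylor's formula gives
`ν ^ n ≤ (3 / 2) μ ^ n + n ^ 2 |E| ^ (n - 2) (ν - μ) ^ 2` for `ν, μ ∈ [0, |E|]`
(`pow_le_add_sq_deviation`). Summed over `a ∈ E`, the first term contributes three quarters of the
claimed bound, and the lower bound on `|E|` makes the second contribute at most the rest
(`IsChainUniformizer.sum_prod_incidences_le`).
-/

/-! ### Galois rings as finite chain rings -/

/-- `π` is a uniformizer of the finite chain ring `R` of length `e`, whose residue field has `r`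
elements. The residue field is encoded by a bound on the annihilator of `π`, which has the same
number of elements as `R / π R`. -/
structure IsChainUniformizer {R : Type*} [CommRing R] (π : R) (r e : ℕ) : Prop where
  pow_eq_zero : π ^ e = 0
  isUnit_of_not_dvd : ∀ x, ¬ π ∣ x → IsUnit x
  card_ann_le : Nat.card {x : R // π * x = 0} ≤ r
  card_eq : Nat.card R = r ^ e

theorem dvd_of_castHom_eq_zero {p e : ℕ} (hp : p.Prime) (h : p ∣ p ^ e) {x : ZMod (p ^ e)}
    (hx : ZMod.castHom h (ZMod p) x = 0) : (p : ZMod (p ^ e)) ∣ x := by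
  have : NeZero (p ^ e) := ⟨(pow_pos hp.pos e).ne'⟩
  rw [← ZMod.natCast_zmod_val x, map_natCast, ZMod.natCast_eq_zero_iff] at hx
  rw [← ZMod.natCast_zmod_val x]
  exact_mod_cast Nat.cast_dvd_cast hx

theorem exists_eq_natCast_mul_of_map_eq_zero {p e : ℕ} (hp : p.Prime) (h : p ∣ p ^ e)
    {g : (ZMod (p ^ e))[X]} (hg : g.map (ZMod.castHom h (ZMod p)) = 0) :
    ∃ w, g = (p : (ZMod (p ^ e))[X]) * w := by
  have : C (p : ZMod (p ^ e)) ∣ g := by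
    rw [C_dvd_iff_dvd_coeff]
    intro i
    apply dvd_of_castHom_eq_zero hp h
    rw [← coeff_map, hg, coeff_zero]
  rwa [map_natCast] at this

/-- An element outside `(p)` is represented by a polynomial coprime to `f` modulo `p`; lifting a
Bézout relation inverts it up to a factor `1 + p w`, which is a unit as `p` is nilpotent. -/
theorem AdjoinRoot.isUnit_of_not_natCast_dvd {p e : ℕ} (hp : p.Prime) (h : p ∣ p ^ e)
    {f : (ZMod (p ^ e))[X]} (hf : Irreducible (f.map (ZMod.castHom h (ZMod p))))
    (x : AdjoinRoot f) (hx : ¬ (p : AdjoinRoot f) ∣ x) : IsUnit x := by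
  have := Fact.mk hp
  obtain ⟨g, rfl⟩ := AdjoinRoot.mk_surjective x
  set φ := ZMod.castHom h (ZMod p)
  have hsurj : Function.Surjective (Polynomial.map φ) :=
    map_surjective φ (ZMod.castHom_surjective h)
  have hcop : IsCoprime (f.map φ) (g.map φ) := by
    rw [hf.coprime_iff_not_dvd]
    rintro ⟨u, hu⟩
    obtain ⟨v, rfl⟩ := hsurj u
    obtain ⟨w, hw⟩ := exists_eq_natCast_mul_of_map_eq_zero hp h (g := g - f * v)
      (by rw [Polynomial.map_sub, Polynomial.map_mul, hu, sub_self])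
    refine hx ⟨AdjoinRoot.mk f w, ?_⟩
    have := congrArg (AdjoinRoot.mk f) hw
    simpa [AdjoinRoot.mk_self] using this
  obtain ⟨u', v', huv⟩ := hcop
  obtain ⟨u, rfl⟩ := hsurj u'
  obtain ⟨v, rfl⟩ := hsurj v'
  obtain ⟨w, hw⟩ := exists_eq_natCast_mul_of_map_eq_zero hp h (g := u * f + v * g - 1)
    (by simp only [Polynomial.map_sub, Polynomial.map_add, Polynomial.map_mul,
          Polynomial.map_one]
        exact sub_eq_zero.2 huv)
  have hvg : AdjoinRoot.mk f v * AdjoinRoot.mk f g = 1 + p * AdjoinRoot.mk f w := by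
    have := congrArg (AdjoinRoot.mk f) hw
    simp only [map_sub, map_add, map_mul, AdjoinRoot.mk_self, mul_zero, zero_add, map_one,
      map_natCast] at this
    rw [← this]; ring
  have hnil : IsNilpotent ((p : AdjoinRoot f) * AdjoinRoot.mk f w) := by
    refine ⟨e, ?_⟩
    have h0 : ((p : (ZMod (p ^ e))[X])) ^ e = 0 := by
      rw [← map_natCast (C : ZMod (p ^ e) →+* (ZMod (p ^ e))[X]), ← map_pow, ← Nat.cast_pow,
        ZMod.natCast_self, map_zero]
    have := congrArg (AdjoinRoot.mk f) h0
    rw [mul_pow]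
    simp only [map_pow, map_natCast, map_zero] at this
    rw [this, zero_mul]
  exact isUnit_of_mul_isUnit_right (hvg ▸ hnil.isUnit_one_add)

theorem ZMod.card_natCast_mul_eq_zero_le {m : ℕ} [NeZero m] {p : ℕ} (hp : 0 < p) :
    Nat.card {x : ZMod m // (p : ZMod m) * x = 0} ≤ p := by
  classical
  rw [Nat.card_eq_fintype_card, Fintype.card_subtype]
  simpa [nsmul_eq_mul] using IsAddCyclic.card_nsmul_eq_zero_le (α := ZMod m) hp

/-- Additively a Galois ring is `(ℤ/p^e)^k`, which gives its cardinality and the size of the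
annihilator of `p`. -/
theorem IsGaloisRing.isChainUniformizer {p e k : ℕ} (hp : p.Prime) {R : Type*} [CommRing R]
    (hR : IsGaloisRing p e k R) : Finite R ∧ IsChainUniformizer (p : R) (p ^ k) e := by
  have : NeZero (p ^ e) := ⟨(pow_pos hp.pos e).ne'⟩
  obtain ⟨h, f, hmonic, rfl, hirr, ⟨ι⟩⟩ := hR
  let B := (AdjoinRoot.powerBasis' hmonic).basis
  have hdim : (AdjoinRoot.powerBasis' hmonic).dim = f.natDegree := AdjoinRoot.powerBasis'_dim hmonic
  let κ : R ≃+ (Fin (AdjoinRoot.powerBasis' hmonic).dim → ZMod (p ^ e)) :=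
    ι.toAddEquiv.trans B.equivFun.toAddEquiv
  have : Finite R := Finite.of_equiv _ κ.symm.toEquiv
  have hκ (x : R) : κ ((p : R) * x) = fun i => (p : ZMod (p ^ e)) * κ x i := by
    rw [← nsmul_eq_mul, map_nsmul]
    ext i
    simp
  refine ⟨inferInstance, ?_, ?_, ?_, ?_⟩
  · apply κ.injective
    rw [map_zero, ← Nat.cast_pow, ← mul_one ((p ^ e : ℕ) : R), ← nsmul_eq_mul, map_nsmul]
    ext i
    simp
  · intro x hx
    have := AdjoinRoot.isUnit_of_not_natCast_dvd hp h hirr (ι x) (fun hd => hx (by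
      have := map_dvd ι.symm hd
      simpa using this))
    simpa using this.map ι.symm
  · calc Nat.card {x : R // (p : R) * x = 0}
        ≤ Nat.card (Fin (AdjoinRoot.powerBasis' hmonic).dim →
            {y : ZMod (p ^ e) // (p : ZMod (p ^ e)) * y = 0}) := by
          refine Nat.card_le_card_of_injective
            (fun x i => ⟨κ x.1 i, by rw [← congrFun (hκ x.1) i, x.2, map_zero]; rfl⟩) ?_
          intro x y hxy
          apply Subtype.ext
          apply κ.injective
          ext i
          exact congrArg Subtype.val (congrFun hxy i)
      _ ≤ p ^ f.natDegree := by
          rw [Nat.card_fun, Nat.card_fin, hdim]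
          exact Nat.pow_le_pow_left (ZMod.card_natCast_mul_eq_zero_le hp.pos) _
  · rw [Nat.card_congr κ.toEquiv, Nat.card_fun, Nat.card_fin, Nat.card_zmod, hdim, ← pow_mul,
      ← pow_mul, mul_comm]

namespace IsChainUniformizer

variable {R : Type*} [CommRing R] {π : R} {r e : ℕ}

theorem exists_eq_pow_mul (h : IsChainUniformizer π r e) {x : R} (hx : x ≠ 0) :
    ∃ i < e, ∃ u, IsUnit u ∧ x = π ^ i * u := by
  classical
  have hex : ∃ i, ¬ π ^ i ∣ x := ⟨e, by simpa [h.pow_eq_zero] using hx⟩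
  obtain ⟨j, hj⟩ : ∃ j, Nat.find hex = j + 1 :=
    Nat.exists_eq_succ_of_ne_zero (fun h0 => Nat.find_spec hex (by simp [h0]))
  obtain ⟨u, hu⟩ : π ^ j ∣ x := not_not.1 (Nat.find_min hex (m := j) (by omega))
  have hnot : ¬ π ^ (j + 1) ∣ x := hj ▸ Nat.find_spec hex
  refine ⟨j, ?_, u, h.isUnit_of_not_dvd u ?_, hu⟩
  · have : Nat.find hex ≤ e := Nat.find_min' hex (by simpa [h.pow_eq_zero] using hx)
    omega
  · rintro ⟨v, rfl⟩
    exact hnot ⟨v, by rw [hu]; ring⟩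

/-- Multiplication by `π` maps the annihilator of `π ^ (i + 1)` to that of `π ^ i`, and its
nonempty fibres are translates of the annihilator of `π`. -/
theorem card_ann_pow_le [Finite R] (h : IsChainUniformizer π r e) (i : ℕ) :
    Nat.card {x : R // π ^ i * x = 0} ≤ r ^ i := by
  classical
  have := Fintype.ofFinite R
  have key (j : ℕ) : Nat.card {x : R // π ^ j * x = 0} =
      (Finset.univ.filter fun x : R => π ^ j * x = 0).card := by
    rw [Nat.card_eq_fintype_card, Fintype.card_subtype]
  have hone : (Finset.univ.filter fun x : R => π * x = 0).card ≤ r := by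
    have := h.card_ann_le
    rwa [Nat.card_eq_fintype_card, Fintype.card_subtype] at this
  rw [key]
  induction i with
  | zero =>
    rw [pow_zero, pow_zero, Finset.card_le_one]
    intro a ha b hb
    simp only [one_mul, Finset.mem_filter, Finset.mem_univ, true_and] at ha hb
    rw [ha, hb]
  | succ i ih =>
    rw [pow_succ r, mul_comm (r ^ i)]
    refine (Finset.card_le_mul_card_image_of_maps_to (f := fun x => π * x)
      (t := Finset.univ.filter fun x : R => π ^ i * x = 0) ?_ r ?_).trans
        (Nat.mul_le_mul_left r ih)
    · intro x hx
      simp only [Finset.mem_filter, Finset.mem_univ, true_and] at hx ⊢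
      rw [← hx]; ring
    · intro y _
      rcases Finset.eq_empty_or_nonempty
        ((Finset.univ.filter fun x : R => π ^ (i + 1) * x = 0).filter fun x => π * x = y)
        with h0 | ⟨z, hz⟩
      · rw [h0]; simp
      · refine le_trans (Finset.card_le_card_of_injOn (fun x => x - z) ?_
          (fun a _ b _ hab => sub_left_injective hab)) hone
        intro x hx
        simp only [Finset.coe_filter, Finset.mem_filter, Finset.mem_univ, true_and,
          Set.mem_ofPred_eq] at hx hz ⊢
        rw [mul_sub, hx.2, hz.2, sub_self]

theorem pow_pred_ne_zero [Finite R] (h : IsChainUniformizer π r e) (hr : 2 ≤ r) (he : 1 ≤ e) :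
    π ^ (e - 1) ≠ 0 := by
  intro h0
  have h1 := h.card_ann_pow_le (e - 1)
  have h2 : Nat.card {x : R // π ^ (e - 1) * x = 0} = Nat.card R :=
    Nat.card_congr (Equiv.subtypeUnivEquiv fun x => by rw [h0, zero_mul])
  rw [h2, h.card_eq] at h1
  exact absurd h1 (not_le.2 (Nat.pow_lt_pow_right (by omega) (by omega)))

/-- A character nontrivial at the generator `π ^ (e - 1)` of the socle is primitive, because every
nonzero element divides that generator. -/
theorem exists_isPrimitive [Finite R] (h : IsChainUniformizer π r e) (hr : 2 ≤ r) (he : 1 ≤ e) :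
    ∃ ψ : AddChar R ℂ, ψ.IsPrimitive := by
  obtain ⟨ψ, hψ⟩ := AddChar.exists_apply_ne_zero.2 (h.pow_pred_ne_zero hr he)
  refine ⟨ψ, fun s hs h1 => hψ ?_⟩
  obtain ⟨i, hi, u, hu, rfl⟩ := h.exists_eq_pow_mul hs
  obtain ⟨v, hv⟩ := hu.exists_right_inv
  have h2 := DFunLike.congr_fun h1 (v * π ^ (e - 1 - i))
  rw [AddChar.mulShift_apply, AddChar.one_apply] at h2
  rw [← h2]
  congr 1
  calc π ^ (e - 1) = π ^ (i + (e - 1 - i)) := by congr 1; omega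
    _ = π ^ i * (u * v) * π ^ (e - 1 - i) := by rw [hv, pow_add, mul_one]
    _ = _ := by ring

/-- The elements of valuation `i` lie in `π ^ i R`, hence in the annihilator of `π ^ (e - i)`,
and their annihilator is that of `π ^ i`; the sum is dominated by `i = e - 1`. -/
theorem sum_card_ann_pow_le [Fintype R] [DecidableEq R] (h : IsChainUniformizer π r e)
    (hr : 1 ≤ r) {d : ℕ} (hd : 1 ≤ d) :
    ∑ s ∈ Finset.univ.erase (0 : R), (Finset.univ.filter fun x : R => s * x = 0).card ^ d ≤
      e * r ^ (1 + (e - 1) * d) := by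
  have key (j : ℕ) : (Finset.univ.filter fun x : R => π ^ j * x = 0).card ≤ r ^ j := by
    rw [← Fintype.card_subtype, ← Nat.card_eq_fintype_card]
    exact h.card_ann_pow_le j
  let T (i : ℕ) : Finset R :=
    Finset.univ.filter fun s => ∃ u, IsUnit u ∧ s = π ^ i * u
  have hex (s : R) : ∃ i, s ≠ 0 → i < e ∧ s ∈ T i := by
    by_cases hs : s = 0
    · exact ⟨0, fun h0 => absurd hs h0⟩
    · obtain ⟨i, hi, u, hu⟩ := h.exists_eq_pow_mul hs
      exact ⟨i, fun _ => ⟨hi, Finset.mem_filter.2 ⟨Finset.mem_univ _, u, hu⟩⟩⟩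
  choose v hv using hex
  have hT (i : ℕ) (hi : i < e) : (T i).card ≤ r ^ (e - i) := by
    refine le_trans (Finset.card_le_card fun s hs => ?_) (key (e - i))
    obtain ⟨u, -, rfl⟩ := (Finset.mem_filter.1 hs).2
    refine Finset.mem_filter.2 ⟨Finset.mem_univ _, ?_⟩
    rw [← mul_assoc, ← pow_add, Nat.sub_add_cancel hi.le, h.pow_eq_zero, zero_mul]
  rw [← Finset.sum_fiberwise_of_maps_to (g := v) (t := Finset.range e)
    fun s hs => Finset.mem_range.2 (hv s (Finset.ne_of_mem_erase hs)).1]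
  calc _ ≤ ∑ i ∈ Finset.range e, ∑ s ∈ T i,
          (Finset.univ.filter fun x : R => s * x = 0).card ^ d := by
        refine Finset.sum_le_sum fun i _ => Finset.sum_le_sum_of_subset fun s hs => ?_
        obtain ⟨hs0, rfl⟩ := Finset.mem_filter.1 hs
        exact (hv s (Finset.ne_of_mem_erase hs0)).2
    _ ≤ ∑ i ∈ Finset.range e, r ^ (1 + (e - 1) * d) := by
        refine Finset.sum_le_sum fun i hi => ?_
        have hi := Finset.mem_range.1 hi
        calc _ ≤ ∑ s ∈ T i, (r ^ i) ^ d := by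
              refine Finset.sum_le_sum fun s hs => Nat.pow_le_pow_left ?_ d
              obtain ⟨u, hu, rfl⟩ := (Finset.mem_filter.1 hs).2
              refine le_trans (Finset.card_le_card fun x hx => ?_) (key i)
              refine Finset.mem_filter.2 ⟨Finset.mem_univ _, ?_⟩
              have hx := (Finset.mem_filter.1 hx).2
              rw [mul_right_comm] at hx
              exact (hu.mul_left_eq_zero).1 hx
          _ ≤ r ^ (e - i) * (r ^ i) ^ d := by
              rw [Finset.sum_const, smul_eq_mul]
              exact Nat.mul_le_mul_right _ (hT i hi)
          _ ≤ r ^ (1 + (e - 1) * d) := by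
              rw [← pow_mul, ← pow_add]
              refine Nat.pow_le_pow_right hr ?_
              obtain ⟨c, rfl⟩ := Nat.exists_eq_add_of_lt hi
              obtain ⟨d, rfl⟩ := Nat.exists_eq_add_of_le hd
              have h1 : i + c + 1 - i = c + 1 := by omega
              have h2 : i + c + 1 - 1 = i + c := by omega
              rw [h1, h2]
              nlinarith [Nat.zero_le (c * d)]
    _ = e * r ^ (1 + (e - 1) * d) := by simp

end IsChainUniformizer

/-! ### Second moment of the incidence function -/

section Variance

variable {R : Type*} [CommRing R] [Fintype R] [DecidableEq R] {d : ℕ}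

theorem AddChar.IsPrimitive.sum_dotProduct {ψ : AddChar R ℂ} (hψ : ψ.IsPrimitive)
    (v : Fin d → R) :
    ∑ a : Fin d → R, ψ (a ⬝ᵥ v) = if v = 0 then (Fintype.card R : ℂ) ^ d else 0 := by
  have h1 : ∑ a : Fin d → R, ψ (a ⬝ᵥ v) = ∏ i, ∑ x : R, ψ (x * v i) := by
    rw [Finset.prod_univ_sum, Fintype.piFinset_univ]
    refine Finset.sum_congr rfl fun a _ => ?_
    exact map_prod ψ.toMonoidHom (fun i => Multiplicative.ofAdd (a i * v i)) Finset.univ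
  rw [h1]
  simp only [AddChar.sum_mulShift _ hψ]
  split_ifs with hv
  · simp [hv]
  · obtain ⟨i, hi⟩ := Function.ne_iff.1 hv
    exact Finset.prod_eq_zero (Finset.mem_univ i) (by simpa using hi)

theorem card_smul_eq_zero (s : R) :
    (Finset.univ.filter fun v : Fin d → R => s • v = 0).card =
      (Finset.univ.filter fun x : R => s * x = 0).card ^ d := by
  have : (Finset.univ.filter fun v : Fin d → R => s • v = 0) =
      Fintype.piFinset fun _ : Fin d => Finset.univ.filter fun x : R => s * x = 0 := by
    ext v
    simp [funext_iff]
  rw [this, Fintype.card_piFinset_const]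

/-- Expanding the square counts the pairs in `E` whose difference is annihilated by `s`. -/
theorem AddChar.IsPrimitive.sum_normSq_le {ψ : AddChar R ℂ} (hψ : ψ.IsPrimitive)
    (E : Finset (Fin d → R)) (s : R) :
    ∑ a : Fin d → R, ‖∑ c ∈ E, ψ (s * (a ⬝ᵥ c))‖ ^ 2 ≤
      (Fintype.card R : ℝ) ^ d * E.card *
        ((Finset.univ.filter fun x : R => s * x = 0).card : ℝ) ^ d := by
  have hsq (a : Fin d → R) : ((‖∑ c ∈ E, ψ (s * (a ⬝ᵥ c))‖ ^ 2 : ℝ) : ℂ) =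
      ∑ c ∈ E, ∑ c' ∈ E, ψ (a ⬝ᵥ (s • (c - c'))) := by
    rw [← Complex.normSq_eq_norm_sq, ← Complex.mul_conj, map_sum, Finset.sum_mul_sum]
    refine Finset.sum_congr rfl fun c _ => Finset.sum_congr rfl fun c' _ => ?_
    rw [← AddChar.map_neg_eq_conj, ← AddChar.map_add_eq_mul]
    congr 1
    rw [dotProduct_smul, dotProduct_sub, smul_eq_mul]
    ring
  have heq : ∑ a : Fin d → R, ‖∑ c ∈ E, ψ (s * (a ⬝ᵥ c))‖ ^ 2 =
      ∑ c ∈ E, ((E.filter fun c' => s • (c - c') = 0).card : ℝ) * (Fintype.card R : ℝ) ^ d := by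
    apply Complex.ofReal_injective
    rw [Complex.ofReal_sum]
    simp only [hsq]
    rw [Finset.sum_comm]
    push_cast
    refine Finset.sum_congr rfl fun c _ => ?_
    rw [Finset.sum_comm]
    simp only [hψ.sum_dotProduct]
    rw [← Finset.sum_filter, Finset.sum_const, nsmul_eq_mul]
  rw [heq]
  calc _ ≤ ∑ c ∈ E, ((Finset.univ.filter fun x : R => s * x = 0).card : ℝ) ^ d *
          (Fintype.card R : ℝ) ^ d := by
        refine Finset.sum_le_sum fun c _ => mul_le_mul_of_nonneg_right ?_ (by positivity)
        rw [← Nat.cast_pow, Nat.cast_le, ← card_smul_eq_zero]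
        refine Finset.card_le_card_of_injOn (fun c' => c - c') ?_
          (fun x _ y _ hxy => sub_right_injective hxy)
        intro c' hc'
        simpa using (Finset.mem_filter.1 hc').2
    _ = _ := by rw [Finset.sum_const, nsmul_eq_mul]; ring

/-- The number of `c ∈ E` on the affine hyperplane `a ⬝ᵥ c = t`. -/
def incidences (E : Finset (Fin d → R)) (t : R) (a : Fin d → R) : ℕ :=
  (E.filter fun c => a ⬝ᵥ c = t).card

/-- Fourier expansion of the incidence function; the frequency `s = 0` gives the mean. -/
theorem AddChar.IsPrimitive.card_mul_incidences_sub {ψ : AddChar R ℂ} (hψ : ψ.IsPrimitive)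
    (E : Finset (Fin d → R)) (t : R) (a : Fin d → R) :
    (Fintype.card R : ℂ) * incidences E t a - E.card =
      ∑ s ∈ Finset.univ.erase (0 : R), ψ (-(s * t)) * ∑ c ∈ E, ψ (s * (a ⬝ᵥ c)) := by
  have h1 : (Fintype.card R : ℂ) * incidences E t a =
      ∑ s : R, ψ (-(s * t)) * ∑ c ∈ E, ψ (s * (a ⬝ᵥ c)) := by
    simp only [Finset.mul_sum]
    rw [Finset.sum_comm]
    have h2 (c : Fin d → R) : ∑ s : R, ψ (-(s * t)) * ψ (s * (a ⬝ᵥ c)) =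
        if a ⬝ᵥ c = t then (Fintype.card R : ℂ) else 0 := by
      have := AddChar.sum_mulShift (a ⬝ᵥ c - t) hψ
      simp only [sub_eq_zero, Nat.cast_ite, Nat.cast_zero] at this
      rw [← this]
      refine Finset.sum_congr rfl fun s _ => ?_
      rw [← AddChar.map_add_eq_mul]
      congr 1
      ring
    simp only [h2]
    rw [← Finset.sum_filter, Finset.sum_const, nsmul_eq_mul, incidences, mul_comm]
  rw [h1, ← Finset.add_sum_erase _ _ (Finset.mem_univ (0 : R))]
  simp

/-- The second moment of the incidence function about its mean, over all of `R ^ d`, by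
orthogonality of characters; Cauchy–Schwarz separates the frequencies `s`. -/
theorem AddChar.IsPrimitive.sum_sq_incidences_sub_le {ψ : AddChar R ℂ} (hψ : ψ.IsPrimitive)
    (E : Finset (Fin d → R)) (t : R) :
    ∑ a : Fin d → R, ((Fintype.card R : ℝ) * incidences E t a - E.card) ^ 2 ≤
      (Fintype.card R : ℝ) ^ (d + 1) * E.card * ∑ s ∈ Finset.univ.erase (0 : R),
        ((Finset.univ.filter fun x : R => s * x = 0).card : ℝ) ^ d := by
  have hpt (a : Fin d → R) : ((Fintype.card R : ℝ) * incidences E t a - E.card) ^ 2 ≤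
      (Fintype.card R : ℝ) * ∑ s ∈ Finset.univ.erase (0 : R),
        ‖∑ c ∈ E, ψ (s * (a ⬝ᵥ c))‖ ^ 2 := by
    have h1 : |(Fintype.card R : ℝ) * incidences E t a - E.card| ≤
        ∑ s ∈ Finset.univ.erase (0 : R), ‖∑ c ∈ E, ψ (s * (a ⬝ᵥ c))‖ := by
      rw [← Real.norm_eq_abs, ← Complex.norm_real]
      push_cast
      rw [hψ.card_mul_incidences_sub]
      refine (norm_sum_le _ _).trans (le_of_eq ?_)
      refine Finset.sum_congr rfl fun s _ => ?_
      rw [norm_mul, AddChar.norm_apply, one_mul]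
    rw [← sq_abs]
    refine (pow_le_pow_left₀ (abs_nonneg _) h1 2).trans (sq_sum_le_card_mul_sum_sq.trans ?_)
    refine mul_le_mul_of_nonneg_right ?_ (Finset.sum_nonneg fun _ _ => by positivity)
    exact_mod_cast Finset.card_le_univ _
  calc _ ≤ ∑ a : Fin d → R, (Fintype.card R : ℝ) * ∑ s ∈ Finset.univ.erase (0 : R),
          ‖∑ c ∈ E, ψ (s * (a ⬝ᵥ c))‖ ^ 2 := Finset.sum_le_sum fun a _ => hpt a
    _ = (Fintype.card R : ℝ) * ∑ s ∈ Finset.univ.erase (0 : R), ∑ a : Fin d → R,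
          ‖∑ c ∈ E, ψ (s * (a ⬝ᵥ c))‖ ^ 2 := by rw [← Finset.mul_sum, Finset.sum_comm]
    _ ≤ (Fintype.card R : ℝ) * ∑ s ∈ Finset.univ.erase (0 : R),
          ((Fintype.card R : ℝ) ^ d * E.card *
            ((Finset.univ.filter fun x : R => s * x = 0).card : ℝ) ^ d) := by
        gcongr
        exact hψ.sum_normSq_le E _
    _ = _ := by rw [← Finset.mul_sum]; ring

end Variance

theorem ncard_rowMatrixSolutions_le {R : Type*} [CommRing R] [DecidableEq R] {d n : ℕ}
    (E : Finset (Fin d → R)) (b : Fin n → R) :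
    (rowMatrixSolutions E b).ncard ≤ ∑ a ∈ E, ∏ j, incidences E (b j) a := by
  let T : Finset ((_ : Fin d → R) × (Fin n → Fin d → R)) :=
    E.sigma fun a => Fintype.piFinset fun j => E.filter fun c => a ⬝ᵥ c = b j
  have hsub : rowMatrixSolutions E b ⊆
      ((T.image fun x => (x.1, Matrix.of fun i j => x.2 j i) :
        Finset ((Fin d → R) × Matrix (Fin d) (Fin n) R)) : Set _) := by
    rintro ⟨a, A⟩ ⟨ha, hA, hb⟩
    refine Finset.mem_coe.2 (Finset.mem_image.2 ⟨⟨a, fun j => A.col j⟩, ?_, rfl⟩)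
    refine Finset.mem_sigma.2 ⟨ha, Fintype.mem_piFinset.2 fun j => Finset.mem_filter.2 ⟨hA j, ?_⟩⟩
    exact congrFun hb j
  calc _ ≤ (T.image fun x => (x.1, Matrix.of fun i j => x.2 j i)).card := by
        rw [← Set.ncard_coe_finset]
        exact Set.ncard_le_ncard hsub (Finset.finite_toSet _)
    _ ≤ T.card := Finset.card_image_le
    _ = _ := by
        rw [Finset.card_sigma]
        refine Finset.sum_congr rfl fun a _ => ?_
        rw [Fintype.card_piFinset]
        rfl

/-! ### Real inequalities -/

/-- Taylor's formula for `x ^ (m + 2)` at `μ`, with the second derivative bounded on `[0, M]`. -/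
theorem pow_le_taylor {x μ M : ℝ} (hx : 0 ≤ x) (hxM : x ≤ M) (hμ : 0 ≤ μ) (hμM : μ ≤ M) (m : ℕ) :
    x ^ (m + 2) ≤ μ ^ (m + 2) + (m + 2) * μ ^ (m + 1) * (x - μ) +
      (m + 1) * (m + 2) / 2 * M ^ m * (x - μ) ^ 2 := by
  induction m with
  | zero => norm_num; nlinarith
  | succ m ih =>
    have h1 := mul_le_mul_of_nonneg_left ih hx
    have h2 : x * ((m + 1) * (m + 2) / 2 * M ^ m * (x - μ) ^ 2) ≤
        M * ((m + 1) * (m + 2) / 2 * M ^ m * (x - μ) ^ 2) :=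
      mul_le_mul_of_nonneg_right hxM (by have := hx.trans hxM; positivity)
    have h3 : (m + 2 : ℝ) * μ ^ (m + 1) * (x - μ) ^ 2 ≤ (m + 2) * M ^ (m + 1) * (x - μ) ^ 2 := by
      gcongr
    push_cast
    calc x ^ (m + 1 + 2) = x * x ^ (m + 2) := by ring
      _ ≤ _ := h1
      _ = μ ^ (m + 1 + 2) + (m + 1 + 2) * μ ^ (m + 1 + 1) * (x - μ) +
          (m + 2 : ℝ) * μ ^ (m + 1) * (x - μ) ^ 2 +
          x * ((m + 1) * (m + 2) / 2 * M ^ m * (x - μ) ^ 2) := by ring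
      _ ≤ μ ^ (m + 1 + 2) + (m + 1 + 2) * μ ^ (m + 1 + 1) * (x - μ) +
          (m + 2 : ℝ) * M ^ (m + 1) * (x - μ) ^ 2 +
          M * ((m + 1) * (m + 2) / 2 * M ^ m * (x - μ) ^ 2) := by linarith
      _ = _ := by ring

theorem pow_le_add_sq_deviation {x μ M : ℝ} (hx : 0 ≤ x) (hxM : x ≤ M) (hμ : 0 ≤ μ) (hμM : μ ≤ M)
    (m : ℕ) :
    x ^ (m + 2) ≤ 3 / 2 * μ ^ (m + 2) + (m + 2 : ℝ) ^ 2 * M ^ m * (x - μ) ^ 2 := by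
  have h1 := pow_le_taylor hx hxM hμ hμM m
  -- the linear term is absorbed by `u v ≤ (u ^ 2 + v ^ 2) / 2`
  have h2 : (m + 2) * μ ^ (m + 1) * (x - μ) ≤
      1 / 2 * μ ^ (m + 2) + (m + 2 : ℝ) ^ 2 / 2 * μ ^ m * (x - μ) ^ 2 := by
    have := mul_nonneg (pow_nonneg hμ m) (sq_nonneg (μ - (m + 2) * (x - μ)))
    have e1 : μ ^ m * (μ - (m + 2) * (x - μ)) ^ 2 = μ ^ (m + 2) -
      2 * ((m + 2) * μ ^ (m + 1) * (x - μ)) + (m + 2 : ℝ) ^ 2 * μ ^ m * (x - μ) ^ 2 := by ring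
    linarith
  have h3 : (m + 2 : ℝ) ^ 2 / 2 * μ ^ m * (x - μ) ^ 2 ≤
      (m + 2 : ℝ) ^ 2 / 2 * M ^ m * (x - μ) ^ 2 := by gcongr
  have h4 : (m + 1) * (m + 2) / 2 * M ^ m * (x - μ) ^ 2 ≤
      (m + 2 : ℝ) ^ 2 / 2 * M ^ m * (x - μ) ^ 2 := by
    have : 0 ≤ M ^ m * (x - μ) ^ 2 := mul_nonneg (pow_nonneg (hx.trans hxM) m) (sq_nonneg _)
    nlinarith [(Nat.cast_nonneg m : (0 : ℝ) ≤ m)]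
  linarith

/-- By AM-GM, a product of `n` functions is summed no worse than the `n`-th power of one. -/
theorem sum_prod_le_of_sum_pow_le {ι : Type*} (s : Finset ι) {n : ℕ} (hn : n ≠ 0)
    (x : Fin n → ι → ℝ) (hx : ∀ j a, 0 ≤ x j a) {B : ℝ} (hB : ∀ j, ∑ a ∈ s, x j a ^ n ≤ B) :
    ∑ a ∈ s, ∏ j, x j a ≤ B := by
  have hn' : (n : ℝ) ≠ 0 := by exact_mod_cast hn
  have amgm (a : ι) : ∏ j, x j a ≤ ∑ j, (n : ℝ)⁻¹ * x j a ^ n := by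
    have := Real.geom_mean_le_arith_mean_weighted Finset.univ (fun _ : Fin n => (n : ℝ)⁻¹)
      (fun j => x j a ^ n) (fun _ _ => by positivity) (by simp [hn'])
      (fun j _ => pow_nonneg (hx j a) n)
    refine le_of_eq_of_le ?_ this
    exact Finset.prod_congr rfl fun j _ => (Real.pow_rpow_inv_natCast (hx j a) hn).symm
  calc _ ≤ ∑ a ∈ s, ∑ j, (n : ℝ)⁻¹ * x j a ^ n := Finset.sum_le_sum fun a _ => amgm a
    _ = ∑ j, (n : ℝ)⁻¹ * ∑ a ∈ s, x j a ^ n := by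
        rw [Finset.sum_comm]; simp only [Finset.mul_sum]
    _ ≤ ∑ j : Fin n, (n : ℝ)⁻¹ * B := by gcongr with j; exact hB j
    _ = B := by simp [hn']

/-! ### The solution count -/

/-- Over any finite chain ring: after AM-GM reduces the product to one factor, the tangent-line
bound splits the `(m + 2)`-th moment of `incidences E t` over `E` into a main term and a multiple
of the second moment, and `hE` makes the latter at most a third of the former. -/
theorem IsChainUniformizer.sum_prod_incidences_le {R : Type*} [CommRing R] [Fintype R]
    [DecidableEq R] {π : R} {r e : ℕ} (h : IsChainUniformizer π r e) (hr : 2 ≤ r) (he : 1 ≤ e)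
    {d m : ℕ} (hd : 1 ≤ d) (E : Finset (Fin d → R)) (b : Fin (m + 2) → R)
    (hE : 2 * (m + 2 : ℝ) ^ 2 * e * ((r : ℝ) ^ e) ^ (d + 1 + m) * (r : ℝ) ^ (1 + (e - 1) * d) ≤
      (E.card : ℝ) ^ 2) :
    ∑ a ∈ E, ∏ j, (incidences E (b j) a : ℝ) ≤
      2 * (E.card : ℝ) ^ (m + 2 + 1) / ((r : ℝ) ^ e) ^ (m + 2) := by
  obtain ⟨ψ, hψ⟩ := h.exists_isPrimitive hr he
  have hcard : (Fintype.card R : ℝ) = (r : ℝ) ^ e := by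
    rw [← Nat.card_eq_fintype_card, h.card_eq, Nat.cast_pow]
  have hann : ∑ s ∈ Finset.univ.erase (0 : R),
      ((Finset.univ.filter fun x : R => s * x = 0).card : ℝ) ^ d ≤
        e * (r : ℝ) ^ (1 + (e - 1) * d) := by
    exact_mod_cast h.sum_card_ann_pow_le (by omega) hd
  set W : ℝ := e * (r : ℝ) ^ (1 + (e - 1) * d)
  set q : ℝ := (r : ℝ) ^ e
  set M : ℝ := (E.card : ℝ)
  have hM : 0 ≤ M := Nat.cast_nonneg _
  have hq : 1 ≤ q := one_le_pow₀ (by exact_mod_cast (by omega : 1 ≤ r))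
  have hq0 : 0 < q := by linarith
  refine sum_prod_le_of_sum_pow_le E (by omega) _ (fun _ _ => Nat.cast_nonneg _) fun j => ?_
  have hvar : ∑ a ∈ E, (q * incidences E (b j) a - M) ^ 2 ≤ q ^ (d + 1) * M * W := by
    refine (Finset.sum_le_sum_of_subset_of_nonneg (Finset.subset_univ E)
      fun _ _ _ => sq_nonneg _).trans ?_
    have := hψ.sum_sq_incidences_sub_le E (b j)
    rw [hcard] at this
    exact this.trans (mul_le_mul_of_nonneg_left hann (by positivity))
  have hpt (a : Fin d → R) : (incidences E (b j) a : ℝ) ^ (m + 2) ≤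
      3 / 2 * (M / q) ^ (m + 2) +
        (m + 2 : ℝ) ^ 2 * M ^ m / q ^ 2 * (q * incidences E (b j) a - M) ^ 2 := by
    refine (pow_le_add_sq_deviation (μ := M / q) (M := M) (Nat.cast_nonneg _) ?_ (by positivity)
      (div_le_self hM hq) m).trans (le_of_eq ?_)
    · exact Nat.cast_le.2 (Finset.card_filter_le _ _)
    · field_simp
  calc _ ≤ ∑ a ∈ E, (3 / 2 * (M / q) ^ (m + 2) +
        (m + 2 : ℝ) ^ 2 * M ^ m / q ^ 2 * (q * incidences E (b j) a - M) ^ 2) :=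
        Finset.sum_le_sum fun a _ => hpt a
    _ = M * (3 / 2 * (M / q) ^ (m + 2)) + (m + 2 : ℝ) ^ 2 * M ^ m / q ^ 2 *
        ∑ a ∈ E, (q * incidences E (b j) a - M) ^ 2 := by
        rw [Finset.sum_add_distrib, Finset.sum_const, nsmul_eq_mul, ← Finset.mul_sum]
    _ ≤ M * (3 / 2 * (M / q) ^ (m + 2)) + (m + 2 : ℝ) ^ 2 * M ^ m / q ^ 2 *
        (q ^ (d + 1) * M * W) := by gcongr
    _ = 3 / 2 * M ^ (m + 3) / q ^ (m + 2) + 1 / 2 * M ^ (m + 1) / q ^ (m + 2) *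
        (2 * (m + 2 : ℝ) ^ 2 * e * q ^ (d + 1 + m) * (r : ℝ) ^ (1 + (e - 1) * d)) := by
        simp only [W, div_pow]
        field_simp
        ring
    _ ≤ 3 / 2 * M ^ (m + 3) / q ^ (m + 2) + 1 / 2 * M ^ (m + 1) / q ^ (m + 2) * M ^ 2 := by
        gcongr
    _ = _ := by field_simp; ring

/-- The lower bound on `|E|`, squared, in integral powers of `p`. Comparing exponents amounts to
`0 ≤ (m + 2) + k`. -/
theorem sq_ge_of_threshold_lt {p e k d m : ℕ} (hp : 1 ≤ p) (he : 1 ≤ e) {M : ℝ}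
    (hM : Real.sqrt 14 * (e : ℝ) * ((m + 2 : ℕ) : ℝ) *
        (p : ℝ) ^ ((d : ℝ) * e * k - (d : ℝ) * k / 2 + ((m + 2 : ℕ) : ℝ) * e * k / 2
          + ((m + 2 : ℕ) : ℝ) / 2 - (e : ℝ) * k / 2 + (k : ℝ)) < M) :
    2 * (m + 2 : ℝ) ^ 2 * e * (((p ^ k : ℕ) : ℝ) ^ e) ^ (d + 1 + m) *
      ((p ^ k : ℕ) : ℝ) ^ (1 + (e - 1) * d) ≤ M ^ 2 := by
  have hp1 : (1 : ℝ) ≤ p := by exact_mod_cast hp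
  have he1 : (1 : ℝ) ≤ e := by exact_mod_cast he
  set x : ℝ := (d : ℝ) * e * k - (d : ℝ) * k / 2 + ((m + 2 : ℕ) : ℝ) * e * k / 2
          + ((m + 2 : ℕ) : ℝ) / 2 - (e : ℝ) * k / 2 + (k : ℝ) with hx
  have hpow : (((p ^ k : ℕ) : ℝ) ^ e) ^ (d + 1 + m) * ((p ^ k : ℕ) : ℝ) ^ (1 + (e - 1) * d) ≤
      ((p : ℝ) ^ x) ^ 2 := by
    rw [Nat.cast_pow, ← pow_mul, ← pow_mul, ← pow_mul, ← pow_add, ← Real.rpow_mul_natCast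
      (by linarith), ← Real.rpow_natCast]
    apply Real.rpow_le_rpow_of_exponent_le hp1
    rw [hx]
    obtain ⟨f, rfl⟩ := Nat.exists_eq_add_of_le' he
    simp only [Nat.add_sub_cancel]
    push_cast
    have : (0 : ℝ) ≤ m + 2 + k := by positivity
    nlinarith
  have hsq : (Real.sqrt 14 * (e : ℝ) * ((m + 2 : ℕ) : ℝ) * (p : ℝ) ^ x) ^ 2 ≤ M ^ 2 :=
    pow_le_pow_left₀ (by positivity) hM.le 2
  refine le_trans ?_ hsq
  have h14 : Real.sqrt 14 ^ 2 = 14 := Real.sq_sqrt (by norm_num)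
  have hexp : (Real.sqrt 14 * (e : ℝ) * ((m + 2 : ℕ) : ℝ) * (p : ℝ) ^ x) ^ 2 =
      14 * (m + 2 : ℝ) ^ 2 * (e : ℝ) ^ 2 * ((p : ℝ) ^ x) ^ 2 := by
    rw [mul_pow, mul_pow, mul_pow, h14]; push_cast; ring
  rw [hexp, mul_assoc (2 * (m + 2 : ℝ) ^ 2 * e)]
  have hee : (e : ℝ) ≤ (e : ℝ) ^ 2 := by nlinarith
  gcongr
  norm_num

theorem theorem1p2 (p e k d n : ℕ) (hp : p.Prime) (hd : 3 ≤ d) (he : 5 ≤ e) (hk : 1 ≤ k)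
    (hn : 4 ≤ n) (R : Type*) [CommRing R] (hR : IsGaloisRing p e k R)
    (E : Finset (Fin d → R)) (b : Fin n → R)
    (hE : Real.sqrt 14 * (e : ℝ) * (n : ℝ) *
        (p : ℝ) ^ ((d : ℝ) * e * k - (d : ℝ) * k / 2 + (n : ℝ) * e * k / 2 + (n : ℝ) / 2
          - (e : ℝ) * k / 2 + (k : ℝ)) < (E.card : ℝ)) :
    ((rowMatrixSolutions E b).ncard : ℝ) ≤
      2 * (E.card : ℝ) ^ (n + 1) / (p : ℝ) ^ (n * e * k) := by
  classical
  obtain ⟨hfin, hchain⟩ := hR.isChainUniformizer hp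
  have := Fintype.ofFinite R
  obtain ⟨m, rfl⟩ := Nat.exists_eq_add_of_le' (show 2 ≤ n by omega)
  have hr : 2 ≤ p ^ k := hp.two_le.trans (Nat.le_self_pow (by omega) p)
  have hcount : ((rowMatrixSolutions E b).ncard : ℝ) ≤
      ∑ a ∈ E, ∏ j, (incidences E (b j) a : ℝ) := by
    exact_mod_cast ncard_rowMatrixSolutions_le E b
  refine hcount.trans ((hchain.sum_prod_incidences_le hr (by omega) (by omega) E b
    (sq_ge_of_threshold_lt hp.one_le (by omega) hE)).trans (le_of_eq ?_))
  rw [Nat.cast_pow, ← pow_mul, ← pow_mul]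
  congr 2
  ring
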